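/- Let $D\ge 1$, let $0\le\alpha<D$, and let $L\subset\mathbb R^D$ be a lattice (a discrete subgroup spanning $\mathbb R^D$). There is a constant $C>0$, depending only on $D$, $\alpha$ and $L$, such that the following holds. Let $\Lambda\subset L$ be a set of $N$ sites, numbered $1,\dots,N$, with mutual Euclidean distances $r_{ij}$, each site carrying a spin with a finite-dimensional Hilbert space (of arbitrary dimension). Let $$H(t)=\sum_{i<j}h_{ij}(t),$$ where each $h_{ij}(t)$ is a Hermitian operator acting on the sites $i$ and $j$ only, depends measurably on $t$, and satisfies $\|h_{ij}(t)\|\le 1/r_{ij}^{\alpha}$ for all $t$ (operator norm). Let $U(t)=\mathcal T\exp\bigl(-i\int_0^tH(s)\,ds\bigr)$ be the time-ordered exponential (the sum of the Dyson series), and let $A(t)=U(t)^\dagger A\,U(t)$. Then for all disjoint $X,Y\subset\Lambda$, all operators $A$ supported on $X$ and $B$ supported on $Y$, and all $t\ge 0$, $$\|[A(t),B]\|\le 2\|A\|\,\|B\|\,|X|\,|Y|\;\frac{e^{2v_Nt}-1}{v_N\,r_{XY}^{\alpha}},\qquad v_N=C\,N^{1-\alpha/D},$$ where $r_{XY}=\min_{i\in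 X,\,j\in Y}r_{ij}$. Thus the rate $2v_N$ in the exponent and the factor $v_N$ in the denominator are both $\Theta(N^{1-\alpha/D})$, with constants depending only on $D$, $\alpha$ and $L$. -/

import Mathlib

open scoped Matrix.Norms.L2Operator

/-- Basis configurations of `N` spins, the `i`-th of which has the Hilbert space `ℂ ^ (d i)`. -/
abbrev SpinConfig {N : ℕ} (d : Fin N → ℕ) : Type := ∀ i, Fin (d i)

/-- Operators on the tensor product of the `ℂ ^ (d i)`, as matrices in the product basis. The norm
is the operator norm (the `ℓ²` operator norm of matrices). -/
abbrev SpinOp {N : ℕ} (d : Fin N → ℕ) : Type := Matrix (SpinConfig d) (SpinConfig d) ℂ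

/-- `A` is supported on the set of sites `X`: it has the form `a ⊗ 1` with `a` acting on the spins
in `X` and `1` the identity on the remaining spins. -/
def IsSupportedOn {N : ℕ} {d : Fin N → ℕ} (X : Finset (Fin N)) (A : SpinOp d) : Prop :=
  ∃ a : Matrix (∀ i : X, Fin (d i)) (∀ i : X, Fin (d i)) ℂ, ∀ σ τ : SpinConfig d,
    A σ τ = if ∀ i, i ∉ X → σ i = τ i then a (X.restrict σ) (X.restrict τ) else 0

/-- The Hamiltonian `H(t) = ∑_{i < j} h_{ij}(t)`. -/
def hamiltonian {N : ℕ} {d : Fin N → ℕ} (h : Fin N → Fin N → ℝ → SpinOp d) (t : ℝ) : SpinOp d :=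
  ∑ i, ∑ j ∈ Finset.Ioi i, h i j t

/-- The terms of the Dyson series: the `n`-th one is
`(-i)ⁿ ∫_{0 ≤ s₁ ≤ … ≤ sₙ ≤ t} H(sₙ) ⋯ H(s₁)`. -/
noncomputable def dysonTerm {N : ℕ} {d : Fin N → ℕ} (H : ℝ → SpinOp d) : ℕ → ℝ → SpinOp d
  | 0, _ => 1
  | n + 1, t => (-Complex.I) • ∫ s in (0 : ℝ)..t, H s * dysonTerm H n s

/-- The time evolution operator `U(t) = 𝒯 exp(-i ∫₀ᵗ H(s) ds)`, as the sum of its Dyson series. -/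
noncomputable def evolution {N : ℕ} {d : Fin N → ℕ} (H : ℝ → SpinOp d) (t : ℝ) : SpinOp d :=
  ∑' n, dysonTerm H n t

/-- The Heisenberg picture `A(t) = U(t)† A U(t)`. -/
noncomputable def heisenberg {N : ℕ} {d : Fin N → ℕ} (H : ℝ → SpinOp d) (A : SpinOp d) (t : ℝ) :
    SpinOp d :=
  (evolution H t).conjTranspose * A * evolution H t

/-- The distance `r_{XY} = min_{i ∈ X, j ∈ Y} r_{ij}` between two sets of sites, the site `i` being
located at the point `x i`. -/
noncomputable def regionDist {D N : ℕ} (x : Fin N → EuclideanSpace ℝ (Fin D))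
    (X Y : Finset (Fin N)) : ℝ :=
  ⨅ p : X × Y, dist (x p.1) (x p.2)

/-! Write `J i j` for `r_{ij} ^ (-α)`, `K` for the part of `H` made of the terms touching `X`, and
`H' = H - K`. If `V` is the evolution of `H'` and `T = V†U`, then `A` commutes with `V`, so `A(t) =
T†AT`. As `[A, B] = 0`, this gives `‖[A(t), B]‖ = ‖[A, TBT† - B]‖ ≤ 2‖A‖ ‖TBT† - B‖`. The derivative
of `TBT†` has norm `‖[K(s), B]‖`, with `K(s)` evolved by `U`. So the commutator is bounded by `2‖A‖`
times an integral of the commutators of `B` with the evolved pair terms meeting `X`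
(`norm_commutator_heisenberg_le`).

This is iterated against an explicit supersolution, `lightConeKernel`. It closes up because `J` is
reproducing with constant `v`: the sums of `J i j * J i l` and `J i j * J j l` over `j` are together
at most `v * J i l`. The error after `n` rounds is of the form `c ^ n / n!` and vanishes in the
limit.

Geometry enters only through `v` (`exists_inv_dist_rpow_reproducing`). In `r_{il} ≤ r_{ij} + r_{jl}`
one of the two distances is at least half of `r_{il}`, so convolutions of `J` reduce to sums `∑ⱼ J i
j`. By packing, these are largest, up to a constant, when the sites fill a ball of radius `N ^ (1 /
D)`, which gives the order `N ^ (1 - α / D)`. -/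

/-! ### Calculus of indefinite integrals, since `H` is only measurable in time. -/

section Primitives

open MeasureTheory

/-- Measurable functions of a real variable that are bounded on bounded sets. -/
structure LocBddMeasurable {E : Type*} [NormedAddCommGroup E] (f : ℝ → E) : Prop where
  meas : AEStronglyMeasurable f
  bdd : ∀ T : ℝ, ∃ M : ℝ, ∀ s, |s| ≤ T → ‖f s‖ ≤ M

/-- `F` is an indefinite integral of the locally bounded measurable function `f`. -/
structure IsPrimitiveOf {E : Type*} [NormedAddCommGroup E] [NormedSpace ℝ E]
    (F f : ℝ → E) : Prop where
  loc : LocBddMeasurable f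
  eq : ∀ t, F t = F 0 + ∫ s in (0 : ℝ)..t, f s

namespace LocBddMeasurable

variable {E : Type*} [NormedAddCommGroup E] {f g : ℝ → E}

theorem of_continuous (hf : Continuous f) : LocBddMeasurable f := by
  refine ⟨hf.aestronglyMeasurable, fun T => ?_⟩
  obtain ⟨M, hM⟩ := (isCompact_Icc (a := -T) (b := T)).exists_bound_of_continuousOn hf.continuousOn
  exact ⟨M, fun s hs => hM s (abs_le.mp hs)⟩

theorem of_bound (hf : AEStronglyMeasurable f) (M : ℝ) (hM : ∀ s, ‖f s‖ ≤ M) :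
    LocBddMeasurable f :=
  ⟨hf, fun _ => ⟨M, fun s _ => hM s⟩⟩

theorem exists_pos_bound (hf : LocBddMeasurable f) (T : ℝ) :
    ∃ M : ℝ, 0 < M ∧ ∀ s, |s| ≤ T → ‖f s‖ ≤ M := by
  obtain ⟨M, hM⟩ := hf.bdd T
  exact ⟨max M 1, by positivity, fun s hs => (hM s hs).trans (le_max_left _ _)⟩

theorem add (hf : LocBddMeasurable f) (hg : LocBddMeasurable g) :
    LocBddMeasurable (fun s => f s + g s) := by
  refine ⟨hf.meas.add hg.meas, fun T => ?_⟩
  obtain ⟨M, hM⟩ := hf.bdd T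
  obtain ⟨M', hM'⟩ := hg.bdd T
  exact ⟨M + M', fun s hs => (norm_add_le _ _).trans (add_le_add (hM s hs) (hM' s hs))⟩

theorem mul {E : Type*} [NormedRing E] {f g : ℝ → E} (hf : LocBddMeasurable f)
    (hg : LocBddMeasurable g) : LocBddMeasurable (fun s => f s * g s) := by
  refine ⟨hf.meas.mul hg.meas, fun T => ?_⟩
  obtain ⟨M, hM0, hM⟩ := hf.exists_pos_bound T
  obtain ⟨M', hM0', hM'⟩ := hg.exists_pos_bound T
  exact ⟨M * M', fun s hs => (norm_mul_le _ _).trans (by gcongr <;> solve_by_elim)⟩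

theorem const_smul {𝕜 : Type*} [NormedField 𝕜] [NormedSpace 𝕜 E] (hf : LocBddMeasurable f)
    (c : 𝕜) : LocBddMeasurable (fun s => c • f s) := by
  refine ⟨hf.meas.const_smul c, fun T => ?_⟩
  obtain ⟨M, hM⟩ := hf.bdd T
  exact ⟨‖c‖ * M, fun s hs => (norm_smul_le _ _).trans (by gcongr; exact hM s hs)⟩

theorem star [StarAddMonoid E] [NormedStarGroup E] (hf : LocBddMeasurable f) :
    LocBddMeasurable (fun s => star (f s)) := by
  refine ⟨continuous_star.comp_aestronglyMeasurable hf.meas, fun T => ?_⟩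
  obtain ⟨M, hM⟩ := hf.bdd T
  exact ⟨M, fun s hs => by rw [norm_star]; exact hM s hs⟩

theorem intervalIntegrable (hf : LocBddMeasurable f) (a b : ℝ) :
    IntervalIntegrable f volume a b := by
  obtain ⟨M, hM⟩ := hf.bdd (max |a| |b|)
  refine (intervalIntegrable_const (c := M) (μ := volume)).mono_fun hf.meas.restrict ?_
  refine (ae_restrict_mem measurableSet_uIoc).mono fun s hs => ?_
  refine (hM s ?_).trans (le_abs_self _)
  rcases Set.mem_uIoc.mp hs with h | h
  · exact abs_le_max_abs_abs h.1.le h.2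
  · rw [max_comm]
    exact abs_le_max_abs_abs h.1.le h.2

end LocBddMeasurable

namespace IsPrimitiveOf

section NormedSpace

variable {E : Type*} [NormedAddCommGroup E] [NormedSpace ℝ E] {F f : ℝ → E}

theorem sub_eq (h : IsPrimitiveOf F f) (a b : ℝ) : F b - F a = ∫ s in a..b, f s := by
  rw [h.eq a, h.eq b, ← intervalIntegral.integral_interval_sub_left (h.loc.intervalIntegrable 0 b)
    (h.loc.intervalIntegrable 0 a)]
  abel

theorem continuous (h : IsPrimitiveOf F f) : Continuous F := by
  rw [show F = fun t => F 0 + ∫ s in (0 : ℝ)..t, f s from funext h.eq]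
  exact continuous_const.add (intervalIntegral.continuous_primitive h.loc.intervalIntegrable 0)

theorem const (c : E) : IsPrimitiveOf (fun _ => c) (fun _ => (0 : E)) :=
  ⟨.of_continuous continuous_const, fun t => by simp⟩

theorem congr {f' : ℝ → E} (h : IsPrimitiveOf F f) (hf : ∀ t, f t = f' t) :
    IsPrimitiveOf F f' := by
  rwa [← show f = f' from funext hf]

end NormedSpace

theorem star {E : Type*} [CStarAlgebra E] {F f : ℝ → E} (h : IsPrimitiveOf F f) :
    IsPrimitiveOf (fun t => star (F t)) (fun t => star (f t)) := by
  refine ⟨h.loc.star, fun t => ?_⟩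
  have := (starL' ℝ (A := E)).toContinuousLinearMap.intervalIntegral_comp_comm
    (h.loc.intervalIntegrable 0 t)
  simp only [ContinuousLinearEquiv.coe_coe, starL'_apply] at this
  rw [h.eq t, star_add, this]

/-- A function whose increments are quadratically small is constant. -/
theorem _root_.eq_of_norm_sub_le_sq {E : Type*} [NormedAddCommGroup E] [NormedSpace ℝ E]
    {K : ℝ → E} (hK : ∀ T, ∃ M : ℝ, ∀ a b, |a| ≤ T → |b| ≤ T → ‖K b - K a‖ ≤ M * |b - a| ^ 2)
    (s t : ℝ) : K s = K t := by
  have hd : ∀ a, HasDerivAt K 0 a := by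
    intro a
    obtain ⟨M, hM⟩ := hK (|a| + 1)
    rw [hasDerivAt_iff_isLittleO]
    simp only [smul_zero, sub_zero]
    refine Asymptotics.IsBigO.trans_isLittleO (g := fun b => (b - a) ^ 2) ?_ ?_
    · refine Asymptotics.IsBigO.of_bound M ?_
      filter_upwards [Metric.ball_mem_nhds a one_pos] with b hb
      rw [Metric.mem_ball, Real.dist_eq] at hb
      have hb' : |b| ≤ |a| + 1 := by
        have := abs_sub_abs_le_abs_sub b a
        linarith
      simpa using hM a b (by linarith) hb'
    · have h0 : Filter.Tendsto (fun b : ℝ => b - a) (nhds a) (nhds 0) := by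
        simpa using (continuous_sub_right a).tendsto a
      exact (Asymptotics.isLittleO_pow_id (𝕜 := ℝ) (n := 2) (by norm_num)).comp_tendsto h0
  exact is_const_of_deriv_eq_zero (𝕜 := ℝ) (fun a => (hd a).differentiableAt)
    (fun a => (hd a).deriv) s t

theorem exists_lipschitz {E : Type*} [NormedAddCommGroup E] [NormedSpace ℝ E] {F f : ℝ → E}
    (h : IsPrimitiveOf F f) (T : ℝ) :
    ∃ M : ℝ, 0 < M ∧ (∀ s, |s| ≤ T → ‖f s‖ ≤ M) ∧
      ∀ a b, |a| ≤ T → |b| ≤ T → ‖F b - F a‖ ≤ M * |b - a| := by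
  obtain ⟨M, hM0, hM⟩ := h.loc.exists_pos_bound T
  refine ⟨M, hM0, hM, fun a b ha hb => ?_⟩
  rw [h.sub_eq]
  refine intervalIntegral.norm_integral_le_of_norm_le_const fun s hs => hM s ?_
  rw [abs_le] at ha hb ⊢
  rcases Set.mem_uIoc.mp hs with h | h <;> constructor <;> linarith

/-- The product rule for indefinite integrals. -/
theorem mul {E : Type*} [NormedRing E] [NormedAlgebra ℝ E] [CompleteSpace E]
    {F f G g : ℝ → E} (hF : IsPrimitiveOf F f) (hG : IsPrimitiveOf G g) :
    IsPrimitiveOf (fun t => F t * G t) (fun t => f t * G t + F t * g t) := by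
  have hFc := LocBddMeasurable.of_continuous hF.continuous
  have hGc := LocBddMeasurable.of_continuous hG.continuous
  have hloc : LocBddMeasurable (fun t => f t * G t + F t * g t) :=
    (hF.loc.mul hGc).add (hFc.mul hG.loc)
  refine ⟨hloc, fun t => ?_⟩
  -- The two sides differ by a function with quadratically small increments, which replaces any
  -- appeal to pointwise derivatives of `F` and `G`.
  have key := eq_of_norm_sub_le_sq
    (K := fun t => F t * G t - ∫ s in (0 : ℝ)..t, (f s * G s + F s * g s)) ?_ t 0
  · simpa [sub_eq_iff_eq_add] using key
  intro T
  obtain ⟨M, hM0, hfM, hFM⟩ := hF.exists_lipschitz T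
  obtain ⟨M', hM0', hgM, hGM⟩ := hG.exists_lipschitz T
  refine ⟨2 * (M * M'), fun a b ha hb => ?_⟩
  have hint := hloc.intervalIntegrable
  -- From `F b * G b - F a * G a = (F b - F a) * G b + F a * (G b - G a)`: each integrand term pairs
  -- a bounded factor with an increment of size `O(|b - a|)`.
  have e1 : (F b * G b - ∫ s in (0 : ℝ)..b, (f s * G s + F s * g s)) -
      (F a * G a - ∫ s in (0 : ℝ)..a, (f s * G s + F s * g s)) =
      ∫ s in a..b, (f s * (G b - G s) + (F a - F s) * g s) := by
    have i1 : IntervalIntegrable (fun s => f s * G b) volume a b :=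
      (hF.loc.mul (.of_continuous continuous_const)).intervalIntegrable a b
    have i2 : IntervalIntegrable (fun s => F a * g s) volume a b :=
      ((LocBddMeasurable.of_continuous continuous_const).mul hG.loc).intervalIntegrable a b
    have e2 : ∀ s, f s * (G b - G s) + (F a - F s) * g s =
        (f s * G b + F a * g s) - (f s * G s + F s * g s) := fun s => by noncomm_ring
    have c1 : ∫ s in a..b, f s * G b = (∫ s in a..b, f s) * G b :=
      ((ContinuousLinearMap.mul ℝ E).flip (G b)).intervalIntegral_comp_comm
        (hF.loc.intervalIntegrable a b)
    have c2 : ∫ s in a..b, F a * g s = F a * ∫ s in a..b, g s :=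
      (ContinuousLinearMap.mul ℝ E (F a)).intervalIntegral_comp_comm
        (hG.loc.intervalIntegrable a b)
    simp only [e2]
    rw [intervalIntegral.integral_sub (i1.add i2) (hint a b), intervalIntegral.integral_add i1 i2,
      c1, c2,
      ← hF.sub_eq, ← hG.sub_eq, ← intervalIntegral.integral_interval_sub_left (hint 0 b) (hint 0 a)]
    noncomm_ring
  rw [e1]
  have : ‖∫ s in a..b, (f s * (G b - G s) + (F a - F s) * g s)‖ ≤
      (2 * (M * M') * |b - a|) * |b - a| := by
    refine intervalIntegral.norm_integral_le_of_norm_le_const fun s hs => ?_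
    have hs' : |s| ≤ T := by
      rw [abs_le] at ha hb ⊢
      rcases Set.mem_uIoc.mp hs with h | h <;> constructor <;> linarith
    have h1 : |b - s| ≤ |b - a| := by
      rcases Set.mem_uIoc.mp hs with h | h
      · rw [abs_of_nonneg (by linarith), abs_of_nonneg (by linarith)]; linarith
      · rw [abs_of_nonpos (by linarith), abs_of_nonpos (by linarith)]; linarith
    have h2 : |a - s| ≤ |b - a| := by
      rcases Set.mem_uIoc.mp hs with h | h
      · rw [abs_of_nonpos (by linarith), abs_of_nonneg (by linarith)]; linarith
      · rw [abs_of_nonneg (by linarith), abs_of_nonpos (by linarith)]; linarith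
    calc ‖f s * (G b - G s) + (F a - F s) * g s‖
        ≤ ‖f s‖ * ‖G b - G s‖ + ‖F a - F s‖ * ‖g s‖ :=
          (norm_add_le _ _).trans (add_le_add (norm_mul_le _ _) (norm_mul_le _ _))
      _ ≤ M * (M' * |b - a|) + (M * |b - a|) * M' := by
          gcongr
          · exact hfM s hs'
          · exact (hGM s b hs' hb).trans (by gcongr)
          · exact (hFM s a hs' ha).trans (by gcongr)
          · exact hgM s hs'
      _ = 2 * (M * M') * |b - a| := by ring
  exact this.trans_eq (by ring)

end IsPrimitiveOf

end Primitives

/-! ### The Dyson series: convergence, evolution equation, unitarity. -/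

section Dyson

open MeasureTheory

variable {N : ℕ} {d : Fin N → ℕ} {H : ℝ → SpinOp d} {M : ℝ}

/-- Only an inequality, because a spin space of dimension `0` makes the operator algebra trivial. -/
theorem norm_one_le_one_of_cstar {E : Type*} [CStarAlgebra E] : ‖(1 : E)‖ ≤ 1 := by
  rcases subsingleton_or_nontrivial E with _ | _
  · rw [Subsingleton.elim (1 : E) 0, norm_zero]; exact zero_le_one
  · exact CStarRing.norm_one.le

theorem continuous_dysonTerm (hH : LocBddMeasurable H) (n : ℕ) : Continuous (dysonTerm H n) := by
  induction n with
  | zero => exact continuous_const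
  | succ n ih =>
    exact (intervalIntegral.continuous_primitive
      (hH.mul (.of_continuous ih)).intervalIntegrable 0).const_smul (-Complex.I)

theorem norm_dysonTerm_le (hM : ∀ s, ‖H s‖ ≤ M) (n : ℕ) (t : ℝ) :
    ‖dysonTerm H n t‖ ≤ (M * |t|) ^ n / n.factorial := by
  have hM0 : 0 ≤ M := (norm_nonneg _).trans (hM 0)
  induction n generalizing t with
  | zero => simpa [dysonTerm] using norm_one_le_one_of_cstar (E := SpinOp d)
  | succ n ih =>
    have hint : IntegrableOn (fun s : ℝ => M ^ (n + 1) / n.factorial * |s - 0| ^ n)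
        (Set.uIoc 0 t) := by
      rw [← intervalIntegrable_iff]
      exact Continuous.intervalIntegrable (by fun_prop) _ _
    calc ‖dysonTerm H (n + 1) t‖ = ‖∫ s in (0 : ℝ)..t, H s * dysonTerm H n s‖ := by
          rw [dysonTerm, norm_smul]; simp
      _ ≤ ∫ s in Set.uIoc 0 t, ‖H s * dysonTerm H n s‖ :=
          intervalIntegral.norm_integral_le_integral_norm_uIoc
      _ ≤ ∫ s in Set.uIoc 0 t, M ^ (n + 1) / n.factorial * |s - 0| ^ n := by
          refine integral_mono_of_nonneg (ae_of_all _ fun s => norm_nonneg _) hint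
            (ae_of_all _ fun s => ?_)
          calc ‖H s * dysonTerm H n s‖ ≤ ‖H s‖ * ‖dysonTerm H n s‖ := norm_mul_le _ _
            _ ≤ M * ((M * |s|) ^ n / n.factorial) := by gcongr; exacts [hM s, ih s]
            _ = M ^ (n + 1) / n.factorial * |s - 0| ^ n := by rw [sub_zero]; ring
      _ = (M * |t|) ^ (n + 1) / (n + 1).factorial := by
          rw [integral_const_mul, integral_pow_abs_sub_uIoc, sub_zero, Nat.factorial_succ]
          push_cast
          field_simp
          rw [mul_pow]

theorem summable_dysonTerm (hM : ∀ s, ‖H s‖ ≤ M) (t : ℝ) :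
    Summable fun n => dysonTerm H n t :=
  .of_norm_bounded (Real.summable_pow_div_factorial _) fun n => norm_dysonTerm_le hM n t

theorem continuous_evolution (hH : AEStronglyMeasurable H) (hM : ∀ s, ‖H s‖ ≤ M) :
    Continuous (evolution H) := by
  have hM0 : 0 ≤ M := (norm_nonneg _).trans (hM 0)
  rw [continuous_iff_continuousAt]
  intro t
  refine ContinuousOn.continuousAt (s := Metric.ball t 1) ?_ (Metric.ball_mem_nhds t one_pos)
  refine continuousOn_tsum
    (fun n => (continuous_dysonTerm (.of_bound hH M hM) n).continuousOn)
    (Real.summable_pow_div_factorial (M * (|t| + 1))) fun n s hs => ?_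
  refine (norm_dysonTerm_le hM n s).trans ?_
  have : |s| ≤ |t| + 1 := by
    rw [Metric.mem_ball, Real.dist_eq] at hs
    have := abs_sub_abs_le_abs_sub s t
    linarith
  gcongr

@[simp]
theorem evolution_zero (H : ℝ → SpinOp d) : evolution H 0 = 1 := by
  rw [evolution, tsum_eq_single 0]
  · rfl
  · intro n hn
    obtain ⟨n, rfl⟩ := Nat.exists_eq_succ_of_ne_zero hn
    simp [dysonTerm]

/-- The evolution operator solves `U' = -i H U` in integrated form. -/
theorem evolution_isPrimitiveOf (hH : AEStronglyMeasurable H) (hM : ∀ s, ‖H s‖ ≤ M) :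
    IsPrimitiveOf (evolution H) fun s => (-Complex.I) • (H s * evolution H s) := by
  have hM0 : 0 ≤ M := (norm_nonneg _).trans (hM 0)
  have hloc : LocBddMeasurable H := .of_bound hH M hM
  refine ⟨(hloc.mul (.of_continuous (continuous_evolution hH hM))).const_smul _, fun t => ?_⟩
  rw [intervalIntegral.integral_smul, evolution_zero]
  have hsum : HasSum (fun n => ∫ s in (0 : ℝ)..t, H s * dysonTerm H n s)
      (∫ s in (0 : ℝ)..t, H s * evolution H s) := by
    have hbd : ∀ s ∈ Set.uIoc 0 t, |s| ≤ |t| := fun s hs => by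
      rcases Set.mem_uIoc.mp hs with h | h
      · exact abs_le_abs_of_nonneg h.1.le h.2
      · exact abs_le_abs_of_nonpos h.2 h.1.le
    refine intervalIntegral.hasSum_integral_of_dominated_convergence
      (fun n _ => M * ((M * |t|) ^ n / n.factorial))
      (fun n => (hH.mul (continuous_dysonTerm hloc n).aestronglyMeasurable).restrict)
      (fun n => ae_of_all _ fun s hs => ?_)
      (ae_of_all _ fun s _ => (Real.summable_pow_div_factorial _).mul_left M)
      intervalIntegrable_const
      (ae_of_all _ fun s _ => (summable_dysonTerm hM s).hasSum.mul_left (H s))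
    have := hbd s hs
    calc ‖H s * dysonTerm H n s‖ ≤ ‖H s‖ * ‖dysonTerm H n s‖ := norm_mul_le _ _
      _ ≤ M * ((M * |s|) ^ n / n.factorial) := by
        gcongr
        exacts [hM s, norm_dysonTerm_le hM n s]
      _ ≤ M * ((M * |t|) ^ n / n.factorial) := by gcongr
  rw [evolution, (summable_dysonTerm hM t).tsum_eq_zero_add]
  congr 1
  exact (hsum.const_smul (-Complex.I)).tsum_eq

/-- The evolution commutes with every operator that commutes with the Hamiltonian at all times. -/
theorem commute_evolution (hH : AEStronglyMeasurable H) (hM : ∀ s, ‖H s‖ ≤ M) {A : SpinOp d}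
    (hA : ∀ s, Commute A (H s)) (t : ℝ) : Commute A (evolution H t) := by
  have hloc : LocBddMeasurable H := .of_bound hH M hM
  have h : ∀ n t, Commute A (dysonTerm H n t) := by
    intro n
    induction n with
    | zero => exact fun _ => Commute.one_right A
    | succ n ih =>
      intro t
      have hi := (hloc.mul (.of_continuous (continuous_dysonTerm hloc n))).intervalIntegrable 0 t
      have c1 := (ContinuousLinearMap.mul ℝ (SpinOp d) A).intervalIntegral_comp_comm hi
      have c2 := ((ContinuousLinearMap.mul ℝ (SpinOp d)).flip A).intervalIntegral_comp_comm hi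
      simp only [ContinuousLinearMap.mul_apply', ContinuousLinearMap.flip_apply] at c1 c2
      refine Commute.smul_right ?_ _
      rw [Commute, SemiconjBy, ← c1, ← c2]
      exact intervalIntegral.integral_congr fun s _ => ((hA s).mul_right (ih s)).eq
  have hs := summable_dysonTerm hM t
  exact (hs.tsum_mul_left A).symm.trans ((tsum_congr fun n => (h n t).eq).trans
    (hs.tsum_mul_right A))

/-- The evolution is unitary. -/
theorem evolution_mem_unitary (hH : AEStronglyMeasurable H) (hM : ∀ s, ‖H s‖ ≤ M)
    (hsa : ∀ s, star (H s) = H s) (t : ℝ) : evolution H t ∈ unitary (SpinOp d) := by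
  have hU := evolution_isPrimitiveOf hH hM
  -- The two terms of the derivative of `U†U` are `iU†HU` and `-iU†HU`. For matrices the resulting
  -- left inverse is two-sided.
  have h := (hU.star.mul hU).congr (f' := fun _ => 0) fun s => by
    simp [star_smul, hsa, mul_assoc]
  have h1 : star (evolution H t) * evolution H t = 1 := by
    simpa using h.eq t
  exact Unitary.mem_iff.mpr ⟨h1, mul_eq_one_comm.mp h1⟩

end Dyson

/-! ### Locality: operators with disjoint supports. -/

section Support

variable {N : ℕ} {d : Fin N → ℕ}

/-- Only one intermediate configuration contributes to the matrix product: `τ` on `X` and `σ`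
elsewhere. The resulting formula is symmetric under exchange of the two factors. -/
theorem mul_apply_of_disjoint {X Y : Finset (Fin N)} (hXY : Disjoint X Y) {A B : SpinOp d}
    {a : Matrix (∀ i : X, Fin (d i)) (∀ i : X, Fin (d i)) ℂ}
    {b : Matrix (∀ i : Y, Fin (d i)) (∀ i : Y, Fin (d i)) ℂ}
    (hA : ∀ σ τ : SpinConfig d,
      A σ τ = if ∀ i, i ∉ X → σ i = τ i then a (X.restrict σ) (X.restrict τ) else 0)
    (hB : ∀ σ τ : SpinConfig d,
      B σ τ = if ∀ i, i ∉ Y → σ i = τ i then b (Y.restrict σ) (Y.restrict τ) else 0)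
    (σ τ : SpinConfig d) :
    (A * B) σ τ = if ∀ i, i ∉ X → i ∉ Y → σ i = τ i then
      a (X.restrict σ) (X.restrict τ) * b (Y.restrict σ) (Y.restrict τ) else 0 := by
  have hYX : ∀ i, i ∈ Y → i ∉ X := fun i hY hX => Finset.disjoint_left.mp hXY hX hY
  rw [Matrix.mul_apply, Finset.sum_eq_single (X.piecewise τ σ)]
  · have h1 : ∀ i, i ∉ X → σ i = X.piecewise τ σ i := fun i hi => by simp [hi]
    have h2 : X.restrict (X.piecewise τ σ) = X.restrict τ := by
      ext ⟨i, hi⟩; simp [hi]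
    have h3 : Y.restrict (X.piecewise τ σ) = Y.restrict σ := by
      ext ⟨i, hi⟩; simp [hYX i hi]
    have h4 : (∀ i, i ∉ Y → X.piecewise τ σ i = τ i) ↔ ∀ i, i ∉ X → i ∉ Y → σ i = τ i := by
      refine forall_congr' fun i => ?_
      by_cases hi : i ∈ X <;> simp [hi]
    rw [hA, hB, if_pos h1, h2, h3]
    simp only [h4, mul_ite, mul_zero]
  · intro ρ _ hρ
    rw [hA, hB]
    by_cases h1 : ∀ i, i ∉ X → σ i = ρ i
    · by_cases h2 : ∀ i, i ∉ Y → ρ i = τ i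
      · refine absurd (funext fun i => ?_) hρ
        by_cases hi : i ∈ X
        · simp [hi, h2 i (Finset.disjoint_left.mp hXY hi)]
        · simp [hi, h1 i hi]
      · rw [if_neg h2, mul_zero]
    · rw [if_neg h1, zero_mul]
  · simp

/-- Operators with disjoint supports commute. -/
theorem IsSupportedOn.commute {X Y : Finset (Fin N)} (hXY : Disjoint X Y) {A B : SpinOp d}
    (hA : IsSupportedOn X A) (hB : IsSupportedOn Y B) : Commute A B := by
  obtain ⟨a, ha⟩ := hA
  obtain ⟨b, hb⟩ := hB
  ext σ τ
  rw [mul_apply_of_disjoint hXY ha hb, mul_apply_of_disjoint hXY.symm hb ha, mul_comm]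
  congr 1
  exact propext ⟨fun h i hY hX => h i hX hY, fun h i hX hY => h i hY hX⟩

end Support

/-! ### The integral inequality for commutators. -/

section LiebRobinson

open MeasureTheory

theorem norm_commutator_le {E : Type*} [NormedRing E] (A B : E) : ‖⁅A, B⁆‖ ≤ 2 * ‖A‖ * ‖B‖ := by
  rw [Ring.lie_def]
  calc ‖A * B - B * A‖ ≤ ‖A‖ * ‖B‖ + ‖B‖ * ‖A‖ :=
        (norm_sub_le _ _).trans (add_le_add (norm_mul_le _ _) (norm_mul_le _ _))
    _ = _ := by ring

section CStar

variable {E : Type*} [CStarAlgebra E]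

theorem norm_star_mul_mul_of_mem_unitary {U : E} (hU : U ∈ unitary E) (A : E) :
    ‖star U * A * U‖ = ‖A‖ := by
  rw [CStarRing.norm_mul_mem_unitary _ hU, CStarRing.norm_mem_unitary_mul _ (Unitary.star_mem hU)]

/-- The left side is what the product rule yields for `V†U b U†V`. The `h` from `U` and the `h'`
from `V` combine into the difference `k`, conjugated by `u`. -/
theorem interaction_derivative {u v h h' k b : E} (hu : u * star u = 1) (hk : h = h' + k)
    (hh : star h = h) (hh' : star h' = h') :
    ((star ((-Complex.I) • (h' * v)) * u + star v * ((-Complex.I) • (h * u))) * b +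
        star v * u * 0) * (star u * v) +
      star v * u * b * (star ((-Complex.I) • (h * u)) * v + star u * ((-Complex.I) • (h' * v))) =
    (-Complex.I) • (star v * u * ⁅star u * k * u, b⁆ * (star u * v)) := by
  have e1 : star v * u * (star u * k * u) = star v * k * u := by
    rw [mul_assoc (star u), mul_assoc, ← mul_assoc u, hu, one_mul, mul_assoc]
  have e2 : star u * k * u * (star u * v) = star u * k * v := by
    rw [mul_assoc _ u, ← mul_assoc u, hu, one_mul]
  have e3 : star v * u * ⁅star u * k * u, b⁆ * (star u * v) =
      star v * k * u * b * (star u * v) - star v * u * b * (star u * k * v) := by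
    rw [Ring.lie_def, mul_sub, sub_mul, ← mul_assoc _ _ b, e1]
    congr 1
    rw [← mul_assoc (star v * u), mul_assoc (star v * u * b), e2]
  have e4 : star v * k * u = star v * h * u - star v * h' * u := by rw [hk]; noncomm_ring
  have e5 : star u * k * v = star u * h * v - star u * h' * v := by rw [hk]; noncomm_ring
  rw [e3, e4, e5]
  simp only [star_smul, star_mul, hh, hh', star_neg, Complex.star_def, Complex.conj_I,
    neg_neg, smul_mul_assoc, mul_smul_comm, mul_zero, add_zero, neg_smul, ← mul_assoc, mul_add,
    add_mul, mul_sub, sub_mul, smul_sub, mul_neg, neg_mul]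
  abel

/-- If `A` commutes with the evolution `V` generated by `H'`, and with `B`, then the commutator of
`B` with `A` evolved by `H' + K` is controlled by the commutators of `B` with the evolved `K`. -/
theorem norm_commutator_le_of_isPrimitiveOf {U V H H' K : ℝ → E}
    (hU : IsPrimitiveOf U fun s => (-Complex.I) • (H s * U s))
    (hV : IsPrimitiveOf V fun s => (-Complex.I) • (H' s * V s))
    (hUu : ∀ s, U s ∈ unitary E) (hVu : ∀ s, V s ∈ unitary E) (hU0 : U 0 = 1) (hV0 : V 0 = 1)
    (hsa : ∀ s, star (H s) = H s) (hsa' : ∀ s, star (H' s) = H' s)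
    (hK : ∀ s, H s = H' s + K s) {A B : E} {t : ℝ} (hVA : Commute A (V t))
    (hAB : Commute A B) {g : ℝ → ℝ} (hg : Continuous g) (ht : 0 ≤ t)
    (hgK : ∀ s, 0 ≤ s → ‖⁅star (U s) * K s * U s, B⁆‖ ≤ g s) :
    ‖⁅star (U t) * A * U t, B⁆‖ ≤ 2 * ‖A‖ * ∫ s in (0 : ℝ)..t, g s := by
  have hU1 : ∀ s, U s * star (U s) = 1 := fun s => Unitary.mul_star_self_of_mem (hUu s)
  have hV1 : V t * star (V t) = 1 := Unitary.mul_star_self_of_mem (hVu t)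
  have hprim : IsPrimitiveOf (fun s => star (V s) * U s * B * (star (U s) * V s))
      (fun s => (-Complex.I) • (star (V s) * U s * ⁅star (U s) * K s * U s, B⁆ *
        (star (U s) * V s))) :=
    (((hV.star.mul hU).mul (.const B)).mul (hU.star.mul hV)).congr fun s =>
      interaction_derivative (hU1 s) (hK s) (hsa s) (hsa' s)
  -- `TBT†` starts at `B`, and unitary factors drop out of the norm of its derivative.
  have hR : ‖star (V t) * U t * B * (star (U t) * V t) - B‖ ≤ ∫ s in (0 : ℝ)..t, g s := by
    have h1 := hprim.sub_eq 0 t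
    simp only [hU0, hV0, star_one, one_mul, mul_one] at h1
    rw [h1]
    refine intervalIntegral.norm_integral_le_of_norm_le ht (ae_of_all _ fun s hs => ?_)
      (hg.intervalIntegrable _ _)
    rw [norm_smul, norm_neg, Complex.norm_I, one_mul,
      CStarRing.norm_mul_mem_unitary _ (mul_mem (Unitary.star_mem (hUu s)) (hVu s)),
      CStarRing.norm_mem_unitary_mul _ (mul_mem (Unitary.star_mem (hVu s)) (hUu s))]
    exact hgK s hs.1.le
  have hT : star (V t) * U t ∈ unitary E := mul_mem (Unitary.star_mem (hVu t)) (hUu t)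
  have hAt : star (U t) * A * U t = star (star (V t) * U t) * A * (star (V t) * U t) := by
    rw [star_mul, star_star]
    calc star (U t) * A * U t = star (U t) * (A * V t * star (V t)) * U t := by
          rw [mul_assoc A, hV1, mul_one]
      _ = _ := by rw [hVA.eq]; simp only [mul_assoc]
  have hstar : star (U t) * V t = star (star (V t) * U t) := by rw [star_mul, star_star]
  rw [hstar] at hR
  rw [hAt]
  have hT1 := Unitary.mul_star_self_of_mem hT
  generalize star (V t) * U t = T at *
  -- Conjugating by `T` moves the evolution onto `B`; subtracting `B` is free because `A` and `B`
  -- commute.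
  have hconj : T * ⁅star T * A * T, B⁆ * star T = ⁅A, T * B * star T - B⁆ := by
    rw [Ring.lie_def, Ring.lie_def, mul_sub, sub_mul, mul_sub, sub_mul, hAB.eq]
    have c1 : T * (star T * A * T * B) * star T = A * (T * B * star T) := by
      calc T * (star T * A * T * B) * star T = (T * star T) * A * (T * B * star T) := by
            simp only [mul_assoc]
        _ = _ := by rw [hT1, one_mul]
    have c2 : T * (B * (star T * A * T)) * star T = T * B * star T * A := by
      calc T * (B * (star T * A * T)) * star T = T * B * star T * A * (T * star T) := by
            simp only [mul_assoc]
        _ = _ := by rw [hT1, mul_one]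
    rw [c1, c2]
    abel
  rw [← CStarRing.norm_mem_unitary_mul _ hT,
    ← CStarRing.norm_mul_mem_unitary _ (Unitary.star_mem hT), hconj]
  refine (norm_commutator_le _ _).trans ?_
  gcongr

end CStar

/-- The integral inequality behind the Lieb-Robinson bound. -/
theorem norm_commutator_heisenberg_le {N : ℕ} {d : Fin N → ℕ} {H H' K : ℝ → SpinOp d} {M M' : ℝ}
    (hH : AEStronglyMeasurable H) (hM : ∀ s, ‖H s‖ ≤ M) (hsa : ∀ s, star (H s) = H s)
    (hH' : AEStronglyMeasurable H') (hM' : ∀ s, ‖H' s‖ ≤ M') (hsa' : ∀ s, star (H' s) = H' s)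
    (hK : ∀ s, H s = H' s + K s) {A B : SpinOp d} (hA : ∀ s, Commute A (H' s))
    (hAB : Commute A B) {g : ℝ → ℝ} (hg : Continuous g) {t : ℝ} (ht : 0 ≤ t)
    (hgK : ∀ s, 0 ≤ s → ‖⁅heisenberg H (K s) s, B⁆‖ ≤ g s) :
    ‖⁅heisenberg H A t, B⁆‖ ≤ 2 * ‖A‖ * ∫ s in (0 : ℝ)..t, g s :=
  norm_commutator_le_of_isPrimitiveOf (evolution_isPrimitiveOf hH hM)
    (evolution_isPrimitiveOf hH' hM') (evolution_mem_unitary hH hM hsa)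
    (evolution_mem_unitary hH' hM' hsa') (evolution_zero H) (evolution_zero H') hsa hsa' hK
    (commute_evolution hH' hM' hA t) hAB hg ht hgK

end LiebRobinson

/-! ### Lattice sums of inverse powers of distances. -/

section Geometry

open MeasureTheory

/-- Bernoulli's inequality for `(1 - 1/m) ^ (1 - p)`, multiplied by `m ^ (1 - p)`. It makes the sum
of the `m ^ (-p)` telescope. -/
theorem rpow_neg_le_rpow_sub_rpow {p : ℝ} (hp0 : 0 ≤ p) (hp1 : p < 1) {m : ℝ} (hm : 1 ≤ m) :
    (1 - p) * m ^ (-p) ≤ m ^ (1 - p) - (m - 1) ^ (1 - p) := by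
  have hm0 : 0 < m := by linarith
  have h := rpow_one_add_le_one_add_mul_self (s := -m⁻¹) (p := 1 - p)
    (neg_le_neg (inv_le_one_of_one_le₀ hm)) (by linarith) (by linarith)
  have e1 : m - 1 = m * (1 + -m⁻¹) := by field_simp; ring
  have h0 : 0 ≤ 1 + -m⁻¹ := by
    have := inv_le_one_of_one_le₀ hm
    linarith
  have e2 : m ^ (1 - p) * m⁻¹ = m ^ (-p) := by
    rw [← Real.rpow_neg_one m, ← Real.rpow_add hm0]
    congr 1; ring
  rw [e1, Real.mul_rpow hm0.le h0]
  have := mul_le_mul_of_nonneg_left h (Real.rpow_nonneg hm0.le (1 - p))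
  nlinarith

/-- If a finite set of points has at most `c r ^ D` points within distance `r`, then the sum of the
`α`-th inverse powers of the distances is of order `n ^ (1 - α / D)`, `n` the number of points. -/
theorem sum_inv_rpow_le {ι : Type*} [DecidableEq ι] {D α c : ℝ} (hD : 0 < D) (hα : 0 ≤ α)
    (hαD : α < D) (hc : 0 < c) (r : ι → ℝ) (s : Finset ι) (hr : ∀ i ∈ s, 0 < r i)
    (hcount : ∀ u ⊆ s, ∀ i ∈ u, (∀ j ∈ u, r j ≤ r i) → (u.card : ℝ) ≤ c * r i ^ D) :
    ∑ i ∈ s, 1 / r i ^ α ≤ c ^ (α / D) / (1 - α / D) * (s.card : ℝ) ^ (1 - α / D) := by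
  have hp0 : 0 ≤ α / D := by positivity
  have hp1 : α / D < 1 := (div_lt_one hD).mpr hαD
  -- Points are added in order of distance: the `m`-th satisfies `m ≤ c r ^ D`, so it contributes at
  -- most `c ^ (α / D) * m ^ (-(α / D))`.
  induction s using Finset.induction_on_max_value r
  · simp [Real.zero_rpow (sub_pos.mpr hp1).ne']
  · rename_i a s ha hmax ih
    have ih' := ih (fun i hi => hr i (Finset.mem_insert_of_mem hi))
      (fun u hu => hcount u (hu.trans (Finset.subset_insert _ _)))
    have hra := hr a (Finset.mem_insert_self _ _)
    have h1 := hcount (insert a s) subset_rfl a (Finset.mem_insert_self _ _) (by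
      intro j hj
      rcases Finset.mem_insert.mp hj with rfl | hj
      · exact le_rfl
      · exact hmax j hj)
    rw [Finset.sum_insert ha]
    rw [Finset.card_insert_of_notMem ha] at h1 ⊢
    push_cast at h1 ⊢
    set m : ℝ := (s.card : ℝ) + 1 with hm
    have hm1 : 1 ≤ m := by rw [hm]; simp
    have hm0 : 0 < m := by linarith
    have h2 : 1 / r a ^ α ≤ c ^ (α / D) * m ^ (-(α / D)) := by
      have h3 : m ^ (α / D) ≤ c ^ (α / D) * r a ^ α := by
        calc m ^ (α / D) ≤ (c * r a ^ D) ^ (α / D) := Real.rpow_le_rpow hm0.le h1 hp0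
          _ = c ^ (α / D) * r a ^ α := by
            rw [Real.mul_rpow hc.le (by positivity), ← Real.rpow_mul hra.le]
            congr 2; field_simp
      rw [Real.rpow_neg hm0.le, div_le_iff₀ (by positivity), ← div_eq_mul_inv, div_mul_eq_mul_div,
        le_div_iff₀ (by positivity), one_mul]
      exact h3
    have h4 := rpow_neg_le_rpow_sub_rpow hp0 hp1 hm1
    have hs : (s.card : ℝ) = m - 1 := by rw [hm]; ring
    rw [hs] at ih'
    have hq : 0 < 1 - α / D := by linarith
    have h5 : c ^ (α / D) * m ^ (-(α / D)) ≤
        c ^ (α / D) / (1 - α / D) * (m ^ (1 - α / D) - (m - 1) ^ (1 - α / D)) := by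
      rw [div_mul_eq_mul_div, le_div_iff₀ hq, mul_assoc]
      gcongr
      linarith
    linarith

/-- Packing bound: a set of points that are `δ`-separated and lie within distance `R ≥ δ` of a point
has at most `(3 R / δ) ^ D` elements. -/
theorem card_le_of_separated {D : ℕ} (hD : 0 < D) {δ R : ℝ} (hδ : 0 < δ) (hR : δ ≤ R)
    {ι : Type*} (u : Finset ι) (x : ι → EuclideanSpace ℝ (Fin D)) (x₀ : EuclideanSpace ℝ (Fin D))
    (hsep : ∀ i ∈ u, ∀ j ∈ u, i ≠ j → δ ≤ dist (x i) (x j))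
    (hu : ∀ i ∈ u, dist x₀ (x i) ≤ R) : (u.card : ℝ) ≤ (3 / δ) ^ D * R ^ D := by
  have : Nontrivial (EuclideanSpace ℝ (Fin D)) := by
    have : Nonempty (Fin D) := ⟨⟨0, hD⟩⟩
    infer_instance
  set μ : Measure (EuclideanSpace ℝ (Fin D)) := volume
  have hR0 : 0 < R := hδ.trans_le hR
  have hdisj : (u : Set ι).PairwiseDisjoint fun i => Metric.ball (x i) (δ / 2) := by
    intro i hi j hj hij
    exact Metric.ball_disjoint_ball (by linarith [hsep i hi j hj hij])
  -- Disjoint balls of radius `δ / 2` fit in one of radius `R + δ / 2 ≤ 3 R / 2`; comparing volumes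
  -- gives the factor `3`.
  have h1 : ∑ i ∈ u, μ (Metric.ball (x i) (δ / 2)) ≤ μ (Metric.ball x₀ (R + δ / 2)) := by
    rw [← measure_biUnion_finset hdisj fun i _ => measurableSet_ball]
    refine measure_mono (Set.iUnion₂_subset fun i hi => Metric.ball_subset_ball' ?_)
    rw [dist_comm]
    linarith [hu i hi]
  simp only [Measure.addHaar_ball μ _ (half_pos hδ).le,
    Measure.addHaar_ball μ x₀ (r := R + δ / 2) (by positivity), Finset.sum_const,
    finrank_euclideanSpace, Fintype.card_fin, nsmul_eq_mul] at h1
  rw [← mul_assoc, ENNReal.mul_le_mul_iff_left (Metric.measure_ball_pos μ 0 one_pos).ne'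
    measure_ball_lt_top.ne, ← ENNReal.ofReal_natCast, ← ENNReal.ofReal_mul (by positivity),
    ENNReal.ofReal_le_ofReal_iff (by positivity)] at h1
  rw [← mul_pow]
  refine le_of_mul_le_mul_right (h1.trans ?_) (by positivity : 0 < (δ / 2) ^ D)
  rw [← mul_pow]
  gcongr
  have : 3 / δ * R * (δ / 2) = 3 / 2 * R := by field_simp
  rw [this]; linarith

theorem exists_separation {D : ℕ} (L : Submodule ℤ (EuclideanSpace ℝ (Fin D)))
    [DiscreteTopology L] : ∃ δ : ℝ, 0 < δ ∧ ∀ x ∈ L, ∀ y ∈ L, x ≠ y → δ ≤ dist x y := by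
  obtain ⟨δ, hδ, h⟩ := Metric.isOpen_singleton_iff.mp (isOpen_discrete {(0 : L)})
  refine ⟨δ, hδ, fun x hx y hy hxy => ?_⟩
  by_contra! hlt
  have := h ⟨x - y, L.sub_mem hx hy⟩ (by
    rw [Subtype.dist_eq]; simpa [dist_eq_norm] using hlt)
  exact hxy (sub_eq_zero.mp (congrArg Subtype.val this))

/-- The sums `∑ₖ r_{ik} ^ (-α)` over `N` sites of a lattice are of order `N ^ (1 - α / D)`. -/
theorem exists_sum_inv_dist_rpow_le {D : ℕ} {α : ℝ} (hα : 0 ≤ α) (hαD : α < D)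
    (L : Submodule ℤ (EuclideanSpace ℝ (Fin D))) [DiscreteTopology L] :
    ∃ C : ℝ, 0 < C ∧ ∀ (N : ℕ) (x : Fin N → EuclideanSpace ℝ (Fin D)),
      Function.Injective x → (∀ i, x i ∈ L) → ∀ i : Fin N,
        ∑ k ∈ Finset.univ.erase i, 1 / dist (x i) (x k) ^ α ≤ C * (N : ℝ) ^ (1 - α / D) := by
  obtain ⟨δ, hδ, hsep⟩ := exists_separation L
  have hD : (0 : ℝ) < D := hα.trans_lt hαD
  have hp1 : α / D < 1 := (div_lt_one hD).mpr hαD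
  have hq : 0 < 1 - α / D := by linarith
  have hc : 0 < (3 / δ) ^ D := by positivity
  refine ⟨((3 / δ) ^ D) ^ (α / D) / (1 - α / D), by positivity, fun N x hx hxL i => ?_⟩
  refine (sum_inv_rpow_le hD hα hαD hc (fun k => dist (x i) (x k)) _ ?_ ?_).trans ?_
  · intro k hk
    exact dist_pos.mpr fun h => (Finset.ne_of_mem_erase hk) (hx h).symm
  · intro u hu k hk hmax
    rw [Real.rpow_natCast]
    refine card_le_of_separated (by exact_mod_cast hD) hδ ?_ u x (x i) ?_ hmax
    · exact hsep _ (hxL i) _ (hxL k) fun h => (Finset.ne_of_mem_erase (hu hk)) (hx h).symm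
    · exact fun a _ b _ hab => hsep _ (hxL a) _ (hxL b) (hx.ne hab)
  · gcongr
    exact (Finset.card_le_univ _).trans_eq (Fintype.card_fin N)

/-- For `r ≤ a + b`, a product `a ^ (-α) b ^ (-α)` is at most `2 ^ α r ^ (-α) (a ^ (-α) + b ^ (-α))`. -/
theorem inv_rpow_mul_inv_rpow_le {α a b r : ℝ} (hα : 0 ≤ α) (ha : 0 < a) (hb : 0 < b) (hr : 0 < r)
    (h : r ≤ a + b) :
    1 / a ^ α * (1 / b ^ α) ≤ 2 ^ α * (1 / r ^ α) * (1 / a ^ α + 1 / b ^ α) := by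
  -- The larger distance is at least `r / 2`, whence the `2 ^ α`.
  wlog hab : a ≤ b generalizing a b
  · have := this hb ha (by linarith) (le_of_not_ge hab)
    linarith
  have h1 : 1 / b ^ α ≤ 2 ^ α * (1 / r ^ α) := by
    have : r ^ α ≤ 2 ^ α * b ^ α := by
      rw [← Real.mul_rpow (by norm_num) hb.le]
      exact Real.rpow_le_rpow hr.le (by linarith) hα
    rw [mul_one_div, div_le_div_iff₀ (by positivity) (by positivity)]
    linarith
  calc 1 / a ^ α * (1 / b ^ α) ≤ 1 / a ^ α * (2 ^ α * (1 / r ^ α)) := by gcongr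
    _ = 2 ^ α * (1 / r ^ α) * (1 / a ^ α) := by ring
    _ ≤ _ := by gcongr; simp; positivity

end Geometry

/-! ### The bounding kernel and sums over pairs. -/

section Combinatorics

/-- The off-diagonal entries of the bounding kernel grow like `J i j (e ^ (2 v t) - 1) / v`, while
its diagonal entries `1` account for the trivial bound. -/
noncomputable def lightConeKernel {N : ℕ} (J : Fin N → Fin N → ℝ) (v : ℝ) (i j : Fin N) (t : ℝ) :
    ℝ :=
  if i = j then 1 else J i j * ((Real.exp (2 * v * t) - 1) / v)

variable {N : ℕ} {J : Fin N → Fin N → ℝ} {v : ℝ}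

theorem growth_nonneg (hv : 0 < v) {t : ℝ} (ht : 0 ≤ t) : 0 ≤ (Real.exp (2 * v * t) - 1) / v :=
  div_nonneg (sub_nonneg.mpr (Real.one_le_exp (by positivity))) hv.le

theorem lightConeKernel_nonneg (hJ : ∀ i j, 0 ≤ J i j) (hv : 0 < v) (i j : Fin N) {t : ℝ}
    (ht : 0 ≤ t) : 0 ≤ lightConeKernel J v i j t := by
  unfold lightConeKernel
  split_ifs
  · exact zero_le_one
  · exact mul_nonneg (hJ i j) (growth_nonneg hv ht)

theorem sum_lightConeKernel_of_disjoint {X Y : Finset (Fin N)} (hXY : Disjoint X Y) (t : ℝ) :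
    ∑ i ∈ X, ∑ l ∈ Y, lightConeKernel J v i l t =
      (∑ i ∈ X, ∑ l ∈ Y, J i l) * ((Real.exp (2 * v * t) - 1) / v) := by
  rw [Finset.sum_mul]
  refine Finset.sum_congr rfl fun i hi => ?_
  rw [Finset.sum_mul]
  refine Finset.sum_congr rfl fun l hl => ?_
  rw [lightConeKernel, if_neg (ne_of_mem_of_not_mem hi (Finset.disjoint_right.mp hXY hl))]

/-- The differential inequality satisfied by the bounding kernel. -/
theorem sum_mul_lightConeKernel_le (hv : 0 < v)
    (hrep : ∀ i l, i ≠ l → ∑ j ∈ Finset.univ.erase i, J i j * J i l +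
      ∑ j ∈ (Finset.univ.erase i).erase l, J i j * J j l ≤ v * J i l)
    {i l : Fin N} (hil : i ≠ l) {t : ℝ} (ht : 0 ≤ t) :
    ∑ j ∈ Finset.univ.erase i, J i j * (lightConeKernel J v i l t + lightConeKernel J v j l t) ≤
      J i l * Real.exp (2 * v * t) := by
  set e := (Real.exp (2 * v * t) - 1) / v with he
  have he0 : 0 ≤ e := growth_nonneg hv ht
  have hl : l ∈ Finset.univ.erase i := by simp [hil.symm]
  have h1 : ∑ j ∈ Finset.univ.erase i, J i j * lightConeKernel J v i l t =
      e * ∑ j ∈ Finset.univ.erase i, J i j * J i l := by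
    rw [Finset.mul_sum]
    refine Finset.sum_congr rfl fun j _ => ?_
    rw [lightConeKernel, if_neg hil, ← he]; ring
  have h2 : ∑ j ∈ Finset.univ.erase i, J i j * lightConeKernel J v j l t =
      J i l + e * ∑ j ∈ (Finset.univ.erase i).erase l, J i j * J j l := by
    -- The term `j = l` meets the diagonal entry `1` and is the source that makes the kernel grow
    -- from zero.
    rw [← Finset.add_sum_erase _ _ hl, Finset.mul_sum]
    congr 1
    · simp [lightConeKernel]
    · refine Finset.sum_congr rfl fun j hj => ?_
      rw [lightConeKernel, if_neg (Finset.ne_of_mem_erase hj), ← he]; ring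
  have h3 : v * e = Real.exp (2 * v * t) - 1 := by rw [he]; field_simp
  simp only [mul_add, Finset.sum_add_distrib]
  rw [h1, h2]
  linear_combination mul_le_mul_of_nonneg_left (hrep i l hil) he0 + J i l * h3

/-- Each pair meeting `X` is charged to its sites in `X`. Pairs inside `X` are counted twice on the
right. -/
theorem sum_pairs_le {w : Fin N → Fin N → ℝ} (hw : ∀ i j, 0 ≤ w i j) (hsymm : ∀ i j, w i j = w j i)
    (X : Finset (Fin N)) :
    ∑ i, ∑ j ∈ Finset.Ioi i, (if i ∈ X ∨ j ∈ X then w i j else 0) ≤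
      ∑ i ∈ X, ∑ j ∈ Finset.univ.erase i, w i j := by
  have h1 : ∑ i, ∑ j ∈ Finset.Ioi i, (if i ∈ X ∨ j ∈ X then w i j else 0) ≤
      ∑ i, ∑ j ∈ Finset.Ioi i, (if i ∈ X then w i j else 0) +
      ∑ i, ∑ j ∈ Finset.Ioi i, (if j ∈ X then w j i else 0) := by
    simp only [← Finset.sum_add_distrib]
    gcongr with i _ j _
    rw [hsymm j i]
    have := hw i j
    split_ifs <;> simp_all
  have h2 : ∑ i, ∑ j ∈ Finset.Ioi i, (if j ∈ X then w j i else 0) =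
      ∑ j, ∑ i ∈ Finset.Iio j, (if j ∈ X then w j i else 0) :=
    Finset.sum_comm' (by simp)
  refine h1.trans_eq ?_
  rw [h2, ← Finset.sum_add_distrib, ← Finset.sum_filter_add_sum_filter_not Finset.univ (· ∈ X)]
  rw [Finset.sum_eq_zero (s := Finset.univ.filter (¬ · ∈ X)), add_zero]
  · rw [Finset.filter_mem_eq_inter, Finset.univ_inter]
    refine Finset.sum_congr rfl fun i hi => ?_
    simp only [hi, if_true]
    rw [← Finset.sum_union]
    · congr 1
      ext j
      simp only [Finset.mem_union, Finset.mem_Ioi, Finset.mem_Iio, Finset.mem_erase,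
        Finset.mem_univ, and_true]
      exact ⟨fun h => h.elim ne_of_gt ne_of_lt, fun h => (lt_or_gt_of_ne h).symm⟩
    · rw [Finset.disjoint_left]
      intro j h3 h4
      simp only [Finset.mem_Ioi, Finset.mem_Iio] at h3 h4
      exact lt_asymm h3 h4
  · intro i hi
    simp [(Finset.mem_filter.mp hi).2]

/-- Bounds the integrand of one round of the recursion; `ρ` is the error left by the previous
rounds, crudely summed over all pairs. -/
theorem sum_pairs_lightConeKernel_le (hJ : ∀ i j, 0 ≤ J i j) (hJs : ∀ i j, J i j = J j i)
    (hv : 0 < v)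
    (hrep : ∀ i l, i ≠ l → ∑ j ∈ Finset.univ.erase i, J i j * J i l +
      ∑ j ∈ (Finset.univ.erase i).erase l, J i j * J j l ≤ v * J i l)
    {X Y : Finset (Fin N)} (hXY : Disjoint X Y) {t : ℝ} (ht : 0 ≤ t) {ρ : ℝ} (hρ : 0 ≤ ρ) :
    ∑ i, ∑ j ∈ Finset.Ioi i, (if i ∈ X ∨ j ∈ X then
      J i j * (∑ l ∈ Y, (lightConeKernel J v i l t + lightConeKernel J v j l t) + ρ) else 0) ≤
    (∑ i ∈ X, ∑ l ∈ Y, J i l) * Real.exp (2 * v * t) + (∑ i, ∑ j ∈ Finset.Ioi i, J i j) * ρ := by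
  have hG := fun i j => lightConeKernel_nonneg hJ hv i j ht
  have h1 := sum_pairs_le
    (w := fun i j => J i j * ∑ l ∈ Y, (lightConeKernel J v i l t + lightConeKernel J v j l t))
    (fun i j => mul_nonneg (hJ i j) (Finset.sum_nonneg fun l _ => add_nonneg (hG _ _) (hG _ _)))
    (fun i j => by simp only [hJs i j, add_comm]) X
  have h2 : ∑ i ∈ X, ∑ j ∈ Finset.univ.erase i,
      J i j * ∑ l ∈ Y, (lightConeKernel J v i l t + lightConeKernel J v j l t) ≤
      (∑ i ∈ X, ∑ l ∈ Y, J i l) * Real.exp (2 * v * t) := by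
    rw [Finset.sum_mul]
    refine Finset.sum_le_sum fun i hi => ?_
    simp only [Finset.mul_sum, Finset.sum_mul]
    rw [Finset.sum_comm]
    refine Finset.sum_le_sum fun l hl => ?_
    exact sum_mul_lightConeKernel_le hv hrep
      (ne_of_mem_of_not_mem hi (Finset.disjoint_right.mp hXY hl)) ht
  refine le_trans ?_ (add_le_add_left (h1.trans h2) _)
  rw [Finset.sum_mul, ← Finset.sum_add_distrib]
  refine Finset.sum_le_sum fun i _ => ?_
  rw [Finset.sum_mul, ← Finset.sum_add_distrib]
  refine Finset.sum_le_sum fun j _ => ?_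
  split_ifs
  · rw [mul_add]
  · rw [zero_add]; exact mul_nonneg (hJ i j) hρ

/-- One round reproduces the off-diagonal kernel exactly and advances the error from order `n` to `n
+ 1`. The `2` of the commutator bound cancels against the rate `2 * v`. -/
theorem two_mul_integral_exp_add_pow (hv : v ≠ 0) (a b κ t : ℝ) (n : ℕ) :
    2 * ∫ s in (0 : ℝ)..t, b * (a * Real.exp (2 * v * s) + κ * ((2 * κ * s) ^ n / n.factorial)) =
      b * (a * ((Real.exp (2 * v * t) - 1) / v) + (2 * κ * t) ^ (n + 1) / (n + 1).factorial) := by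
  have hd : ∀ s, HasDerivAt (fun s => b / 2 * (a * (Real.exp (2 * v * s) / v) +
      (2 * κ * s) ^ (n + 1) / (n + 1).factorial))
      (b * (a * Real.exp (2 * v * s) + κ * ((2 * κ * s) ^ n / n.factorial))) s := by
    intro s
    have h1 : HasDerivAt (fun s => 2 * v * s) (2 * v) s := by
      simpa using (hasDerivAt_id s).const_mul (2 * v)
    have h2 : HasDerivAt (fun s => 2 * κ * s) (2 * κ) s := by
      simpa using (hasDerivAt_id s).const_mul (2 * κ)
    refine ((((h1.exp.div_const v).const_mul a).add
      ((h2.pow (n + 1)).div_const ((n + 1).factorial : ℝ))).const_mul (b / 2)).congr_deriv ?_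
    rw [Nat.factorial_succ]
    push_cast
    have : (n.factorial : ℝ) ≠ 0 := by positivity
    have : (n : ℝ) + 1 ≠ 0 := by positivity
    field_simp
  rw [intervalIntegral.integral_eq_sub_of_hasDerivAt (fun s _ => hd s)
    (Continuous.intervalIntegrable (by fun_prop) _ _)]
  simp
  field_simp
  ring

end Combinatorics

/-! ### Regularity and linearity of the Hamiltonian. -/

section Hamiltonian

open MeasureTheory

variable {N : ℕ} {d : Fin N → ℕ} {h : Fin N → Fin N → ℝ → SpinOp d}

theorem aestronglyMeasurable_hamiltonian (hm : ∀ i j, i < j → AEStronglyMeasurable (h i j)) :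
    AEStronglyMeasurable (hamiltonian h) := by
  have : hamiltonian h = fun t => ∑ i, ∑ j ∈ Finset.Ioi i, h i j t := rfl
  rw [this]
  exact Finset.aestronglyMeasurable_fun_sum _ fun i _ =>
    Finset.aestronglyMeasurable_fun_sum _ fun j hj => hm i j (Finset.mem_Ioi.mp hj)

theorem norm_hamiltonian_le {J : Fin N → Fin N → ℝ} (hJ : ∀ i j, i < j → ∀ s, ‖h i j s‖ ≤ J i j)
    (s : ℝ) : ‖hamiltonian h s‖ ≤ ∑ i, ∑ j ∈ Finset.Ioi i, J i j :=
  norm_sum_le_of_le _ fun i _ => norm_sum_le_of_le _ fun j hj => hJ i j (Finset.mem_Ioi.mp hj) s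

theorem star_hamiltonian (hh : ∀ i j, i < j → ∀ s, (h i j s).IsHermitian) (s : ℝ) :
    star (hamiltonian h s) = hamiltonian h s := by
  simp only [hamiltonian, star_sum]
  exact Finset.sum_congr rfl fun i _ => Finset.sum_congr rfl fun j hj =>
    hh i j (Finset.mem_Ioi.mp hj) s

theorem commute_hamiltonian {A : SpinOp d} {s : ℝ} (hA : ∀ i j, i < j → Commute A (h i j s)) :
    Commute A (hamiltonian h s) :=
  Commute.sum_right _ _ _ fun i _ => Commute.sum_right _ _ _ fun j hj =>
    hA i j (Finset.mem_Ioi.mp hj)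

theorem commutator_heisenberg_hamiltonian (H : ℝ → SpinOp d) (B : SpinOp d) (s : ℝ) :
    ⁅heisenberg H (hamiltonian h s) s, B⁆ =
      ∑ i, ∑ j ∈ Finset.Ioi i, ⁅heisenberg H (h i j s) s, B⁆ := by
  simp only [heisenberg, hamiltonian, Ring.lie_def, Finset.mul_sum, Finset.sum_mul,
    Finset.sum_sub_distrib]

theorem commutator_heisenberg_zero (H : ℝ → SpinOp d) (B : SpinOp d) (s : ℝ) :
    ⁅heisenberg H 0 s, B⁆ = 0 := by
  simp [heisenberg, Ring.lie_def]

end Hamiltonian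

/-! ### Iterating the inequality and passing to the limit. -/

section LightCone

open MeasureTheory

variable {N : ℕ} {d : Fin N → ℕ} {h : Fin N → Fin N → ℝ → SpinOp d} {J : Fin N → Fin N → ℝ} {v : ℝ}

/-- The Lieb-Robinson recursion: iterating the integral inequality `n` times. -/
theorem norm_commutator_heisenberg_le_iterate
    (hm : ∀ i j, i < j → AEStronglyMeasurable (h i j))
    (hh : ∀ i j, i < j → ∀ s, (h i j s).IsHermitian)
    (hsupp : ∀ i j, i < j → ∀ s, IsSupportedOn {i, j} (h i j s))
    (hhJ : ∀ i j, i < j → ∀ s, ‖h i j s‖ ≤ J i j)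
    (hJ : ∀ i j, 0 ≤ J i j) (hJs : ∀ i j, J i j = J j i) (hv : 0 < v)
    (hrep : ∀ i l, i ≠ l → ∑ j ∈ Finset.univ.erase i, J i j * J i l +
      ∑ j ∈ (Finset.univ.erase i).erase l, J i j * J j l ≤ v * J i l)
    {Y : Finset (Fin N)} {B : SpinOp d} (hB : IsSupportedOn Y B) (n : ℕ)
    {X : Finset (Fin N)} (hXY : Disjoint X Y) {A : SpinOp d} (hA : IsSupportedOn X A) {t : ℝ}
    (ht : 0 ≤ t) :
    ‖⁅heisenberg (hamiltonian h) A t, B⁆‖ ≤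
      ‖A‖ * (2 * ‖B‖ * (∑ i ∈ X, ∑ l ∈ Y, lightConeKernel J v i l t +
        (2 * (∑ i, ∑ j ∈ Finset.Ioi i, J i j) * t) ^ n / n.factorial)) := by
  set κ := ∑ i, ∑ j ∈ Finset.Ioi i, J i j with hκ
  have hκ0 : 0 ≤ κ := Finset.sum_nonneg fun i _ => Finset.sum_nonneg fun j _ => hJ i j
  have hmeas := aestronglyMeasurable_hamiltonian hm
  have hbd := norm_hamiltonian_le hhJ
  have hsa := star_hamiltonian hh
  have htriv : ∀ (A : SpinOp d) (s : ℝ),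
      ‖⁅heisenberg (hamiltonian h) A s, B⁆‖ ≤ 2 * ‖A‖ * ‖B‖ := by
    intro A s
    refine (norm_commutator_le _ _).trans_eq ?_
    rw [heisenberg, ← Matrix.star_eq_conjTranspose,
      norm_star_mul_mul_of_mem_unitary (evolution_mem_unitary hmeas hbd hsa s)]
  have hG : ∀ {s : ℝ}, 0 ≤ s → ∀ i j, 0 ≤ lightConeKernel J v i j s :=
    fun hs i j => lightConeKernel_nonneg hJ hv i j hs
  -- The next round applies the bound to the pair terms, so region, operator and time must vary. At
  -- `n = 0` the error is `1`, which is the trivial bound.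
  induction n generalizing X A t with
  | zero =>
    have h1 : 0 ≤ ∑ i ∈ X, ∑ l ∈ Y, lightConeKernel J v i l t :=
      Finset.sum_nonneg fun i _ => Finset.sum_nonneg fun l _ => hG ht i l
    calc ‖⁅heisenberg (hamiltonian h) A t, B⁆‖ ≤ 2 * ‖A‖ * ‖B‖ := htriv A t
      _ = ‖A‖ * (2 * ‖B‖ * (0 + 1)) := by ring
      _ ≤ _ := by gcongr; simp
  | succ n ih =>
    have hpair : ∀ i j, i < j → ∀ s, 0 ≤ s → ‖⁅heisenberg (hamiltonian h) (h i j s) s, B⁆‖ ≤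
        2 * ‖B‖ * (J i j * (∑ l ∈ Y, (lightConeKernel J v i l s + lightConeKernel J v j l s) +
          (2 * κ * s) ^ n / n.factorial)) := by
      intro i j hij s hs
      have hsum : ∑ i ∈ {i, j}, ∑ l ∈ Y, lightConeKernel J v i l s =
          ∑ l ∈ Y, (lightConeKernel J v i l s + lightConeKernel J v j l s) := by
        rw [Finset.sum_pair hij.ne, Finset.sum_add_distrib]
      have hn : 0 ≤ ∑ l ∈ Y, (lightConeKernel J v i l s + lightConeKernel J v j l s) :=
        Finset.sum_nonneg fun l _ => add_nonneg (hG hs _ _) (hG hs _ _)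
      by_cases hd : Disjoint {i, j} Y
      · refine (ih hd (hsupp i j hij s) hs).trans ?_
        rw [hsum, mul_left_comm]
        gcongr
        exact hhJ i j hij s
      -- A pair that meets `Y` falls outside the induction hypothesis; a diagonal entry `1` of the
      -- kernel then covers the trivial bound.
      · have h1 : 1 ≤ ∑ l ∈ Y, (lightConeKernel J v i l s + lightConeKernel J v j l s) := by
          obtain ⟨l, hl, hlY⟩ := Finset.not_disjoint_iff.mp hd
          refine le_trans ?_ (Finset.single_le_sum
            (fun l _ => add_nonneg (hG hs i l) (hG hs j l)) hlY)
          rcases Finset.mem_insert.mp hl with rfl | hl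
          · have := hG hs j l
            simpa [lightConeKernel] using this
          · obtain rfl := Finset.mem_singleton.mp hl
            have := hG hs i l
            simpa [lightConeKernel] using this
        calc ‖⁅heisenberg (hamiltonian h) (h i j s) s, B⁆‖ ≤ 2 * ‖h i j s‖ * ‖B‖ := htriv _ s
          _ ≤ 2 * J i j * ‖B‖ := by gcongr; exact hhJ i j hij s
          _ = 2 * ‖B‖ * (J i j * (1 + 0)) := by ring
          _ ≤ _ := by
            have := hJ i j
            gcongr
            positivity
    -- Deleting every pair that meets `X` leaves a Hamiltonian commuting with `A`.
    set h' : Fin N → Fin N → ℝ → SpinOp d := fun i j s => if i ∈ X ∨ j ∈ X then 0 else h i j s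
      with hh'def
    set hX : Fin N → Fin N → ℝ → SpinOp d := fun i j s => if i ∈ X ∨ j ∈ X then h i j s else 0
      with hXdef
    have hsplit : ∀ s, hamiltonian h s = hamiltonian h' s + hamiltonian hX s := by
      intro s
      simp only [hamiltonian, ← Finset.sum_add_distrib]
      refine Finset.sum_congr rfl fun i _ => Finset.sum_congr rfl fun j _ => ?_
      by_cases hc : i ∈ X ∨ j ∈ X <;> simp [hh'def, hXdef, hc]
    have hm' : ∀ i j, i < j → AEStronglyMeasurable (h' i j) := by
      intro i j hij
      by_cases hc : i ∈ X ∨ j ∈ X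
      · simpa only [hh'def, hc, if_true] using aestronglyMeasurable_const
      · simpa only [hh'def, hc, if_false] using hm i j hij
    have hhJ' : ∀ i j, i < j → ∀ s, ‖h' i j s‖ ≤ J i j := by
      intro i j hij s
      by_cases hc : i ∈ X ∨ j ∈ X
      · simpa only [hh'def, hc, if_true, norm_zero] using hJ i j
      · simpa only [hh'def, hc, if_false] using hhJ i j hij s
    have hh' : ∀ i j, i < j → ∀ s, (h' i j s).IsHermitian := by
      intro i j hij s
      by_cases hc : i ∈ X ∨ j ∈ X
      · simpa only [hh'def, hc, if_true] using Matrix.isHermitian_zero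
      · simpa only [hh'def, hc, if_false] using hh i j hij s
    have hcomm : ∀ s, Commute A (hamiltonian h' s) := by
      refine fun s => commute_hamiltonian fun i j hij => ?_
      by_cases hc : i ∈ X ∨ j ∈ X
      · simpa only [hh'def, hc, if_true] using Commute.zero_right A
      · simp only [hh'def, hc, if_false]
        refine IsSupportedOn.commute ?_ hA (hsupp i j hij s)
        rw [not_or] at hc
        simpa using hc
    have hstep := norm_commutator_heisenberg_le hmeas hbd hsa (aestronglyMeasurable_hamiltonian hm')
      (norm_hamiltonian_le hhJ') (star_hamiltonian hh') hsplit hcomm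
      (IsSupportedOn.commute hXY hA hB)
      (g := fun s => 2 * ‖B‖ * ((∑ i ∈ X, ∑ l ∈ Y, J i l) * Real.exp (2 * v * s) +
        κ * ((2 * κ * s) ^ n / n.factorial))) (by fun_prop) ht ?_
    · refine hstep.trans_eq ?_
      rw [mul_comm 2 ‖A‖, mul_assoc, two_mul_integral_exp_add_pow hv.ne',
        sum_lightConeKernel_of_disjoint hXY]
    · intro s hs
      refine le_trans ?_ (mul_le_mul_of_nonneg_left (sum_pairs_lightConeKernel_le hJ hJs hv hrep
        hXY hs (ρ := (2 * κ * s) ^ n / n.factorial) (by positivity)) (by positivity))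
      rw [commutator_heisenberg_hamiltonian, Finset.mul_sum]
      refine norm_sum_le_of_le _ fun i _ => ?_
      rw [Finset.mul_sum]
      refine norm_sum_le_of_le _ fun j hj => ?_
      by_cases hc : i ∈ X ∨ j ∈ X
      · simp only [hXdef, hc, if_true]
        exact hpair i j (Finset.mem_Ioi.mp hj) s hs
      · simp only [hXdef, hc, if_false, commutator_heisenberg_zero, norm_zero, mul_zero, le_refl]

/-- The Lieb-Robinson bound for two-body interactions dominated by a reproducing kernel. -/
theorem norm_commutator_heisenberg_le_sum
    (hm : ∀ i j, i < j → AEStronglyMeasurable (h i j))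
    (hh : ∀ i j, i < j → ∀ s, (h i j s).IsHermitian)
    (hsupp : ∀ i j, i < j → ∀ s, IsSupportedOn {i, j} (h i j s))
    (hhJ : ∀ i j, i < j → ∀ s, ‖h i j s‖ ≤ J i j)
    (hJ : ∀ i j, 0 ≤ J i j) (hJs : ∀ i j, J i j = J j i) (hv : 0 < v)
    (hrep : ∀ i l, i ≠ l → ∑ j ∈ Finset.univ.erase i, J i j * J i l +
      ∑ j ∈ (Finset.univ.erase i).erase l, J i j * J j l ≤ v * J i l)
    {X Y : Finset (Fin N)} (hXY : Disjoint X Y) {A B : SpinOp d} (hA : IsSupportedOn X A)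
    (hB : IsSupportedOn Y B) {t : ℝ} (ht : 0 ≤ t) :
    ‖⁅heisenberg (hamiltonian h) A t, B⁆‖ ≤
      2 * ‖A‖ * ‖B‖ * ((∑ i ∈ X, ∑ l ∈ Y, J i l) * ((Real.exp (2 * v * t) - 1) / v)) := by
  have hlim := (((FloorSemiring.tendsto_pow_div_factorial_atTop
    (2 * (∑ i, ∑ j ∈ Finset.Ioi i, J i j) * t)).const_add
      (∑ i ∈ X, ∑ l ∈ Y, lightConeKernel J v i l t)).const_mul (2 * ‖B‖)).const_mul ‖A‖
  refine (ge_of_tendsto' hlim fun n => norm_commutator_heisenberg_le_iterate hm hh hsupp hhJ hJ hJs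
    hv hrep hB n hXY hA ht).trans_eq ?_
  rw [sum_lightConeKernel_of_disjoint hXY]
  ring

end LightCone

/-! ### Power-law interactions on a lattice. -/

/-- The kernel `r_{ij} ^ (-α)` is reproducing, with constant of order `N ^ (1 - α / D)`. -/
theorem exists_inv_dist_rpow_reproducing {D : ℕ} {α : ℝ} (hα : 0 ≤ α) (hαD : α < D)
    (L : Submodule ℤ (EuclideanSpace ℝ (Fin D))) [DiscreteTopology L] :
    ∃ C : ℝ, 0 < C ∧ ∀ (N : ℕ) (x : Fin N → EuclideanSpace ℝ (Fin D)),
      Function.Injective x → (∀ i, x i ∈ L) → ∀ i l, i ≠ l →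
        ∑ j ∈ Finset.univ.erase i, 1 / dist (x i) (x j) ^ α * (1 / dist (x i) (x l) ^ α) +
          ∑ j ∈ (Finset.univ.erase i).erase l,
            1 / dist (x i) (x j) ^ α * (1 / dist (x j) (x l) ^ α) ≤
          C * (N : ℝ) ^ (1 - α / D) * (1 / dist (x i) (x l) ^ α) := by
  obtain ⟨C, hC, hsum⟩ := exists_sum_inv_dist_rpow_le hα hαD L
  -- The first `C` bounds the sum of `J i j * J i l`; the other two bound the row sums at `i` and at
  -- `l` after the triangle inequality.
  refine ⟨C + 2 ^ α * (C + C), by positivity, fun N x hx hxL i l hil => ?_⟩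
  set S := C * (N : ℝ) ^ (1 - α / D) with hS
  set r := 1 / dist (x i) (x l) ^ α with hr
  have hr0 : 0 ≤ r := by positivity
  have h1 : ∑ j ∈ Finset.univ.erase i, 1 / dist (x i) (x j) ^ α * r ≤ S * r := by
    rw [← Finset.sum_mul]
    exact mul_le_mul_of_nonneg_right (hsum N x hx hxL i) hr0
  have h2 : ∑ j ∈ (Finset.univ.erase i).erase l,
      1 / dist (x i) (x j) ^ α * (1 / dist (x j) (x l) ^ α) ≤ 2 ^ α * r * (S + S) := by
    calc _ ≤ ∑ j ∈ (Finset.univ.erase i).erase l,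
          2 ^ α * r * (1 / dist (x i) (x j) ^ α + 1 / dist (x j) (x l) ^ α) := by
          refine Finset.sum_le_sum fun j hj => ?_
          have hjl := Finset.ne_of_mem_erase hj
          have hji := Finset.ne_of_mem_erase (Finset.mem_of_mem_erase hj)
          exact inv_rpow_mul_inv_rpow_le hα (dist_pos.mpr (hx.ne hji.symm))
            (dist_pos.mpr (hx.ne hjl)) (dist_pos.mpr (hx.ne hil)) (dist_triangle _ _ _)
      _ ≤ _ := by
          rw [← Finset.mul_sum, Finset.sum_add_distrib]
          gcongr
          · exact (Finset.sum_le_sum_of_subset_of_nonneg (Finset.erase_subset _ _)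
              fun _ _ _ => by positivity).trans (hsum N x hx hxL i)
          · simp only [dist_comm _ (x l)]
            exact (Finset.sum_le_sum_of_subset_of_nonneg
              (Finset.erase_subset_erase _ (Finset.subset_univ _))
              fun _ _ _ => by positivity).trans (hsum N x hx hxL l)
  calc _ ≤ S * r + 2 ^ α * r * (S + S) := add_le_add h1 h2
    _ = _ := by rw [hS]; ring

theorem regionDist_le {D N : ℕ} (x : Fin N → EuclideanSpace ℝ (Fin D)) {X Y : Finset (Fin N)}
    {i j : Fin N} (hi : i ∈ X) (hj : j ∈ Y) : regionDist x X Y ≤ dist (x i) (x j) :=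
  ciInf_le (Set.finite_range _).bddBelow ((⟨i, hi⟩, ⟨j, hj⟩) : X × Y)

theorem regionDist_pos {D N : ℕ} {x : Fin N → EuclideanSpace ℝ (Fin D)}
    (hx : Function.Injective x) {X Y : Finset (Fin N)} (hXY : Disjoint X Y) (hX : X.Nonempty)
    (hY : Y.Nonempty) : 0 < regionDist x X Y := by
  have := hX.to_subtype
  have := hY.to_subtype
  obtain ⟨p, hp⟩ := exists_eq_ciInf_of_finite (f := fun p : X × Y => dist (x p.1) (x p.2))
  rw [regionDist, ← hp]
  exact dist_pos.mpr (hx.ne (ne_of_mem_of_not_mem p.1.2 (Finset.disjoint_right.mp hXY p.2.2)))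

theorem sum_inv_dist_rpow_le_card {D N : ℕ} {α : ℝ} (hα : 0 ≤ α)
    {x : Fin N → EuclideanSpace ℝ (Fin D)} (hx : Function.Injective x) {X Y : Finset (Fin N)}
    (hXY : Disjoint X Y) :
    ∑ i ∈ X, ∑ j ∈ Y, 1 / dist (x i) (x j) ^ α ≤
      (X.card : ℝ) * (Y.card : ℝ) * (1 / regionDist x X Y ^ α) := by
  have h : ∀ i ∈ X, ∀ j ∈ Y, 1 / dist (x i) (x j) ^ α ≤ 1 / regionDist x X Y ^ α := by
    intro i hi j hj
    -- Positivity is needed only once sites are given. For empty `X` or `Y`, where the infimum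
    -- defaults to `0`, both sides vanish.
    have hpos := regionDist_pos hx hXY ⟨i, hi⟩ ⟨j, hj⟩
    gcongr
    exact regionDist_le x hi hj
  calc _ ≤ ∑ i ∈ X, ∑ j ∈ Y, 1 / regionDist x X Y ^ α :=
        Finset.sum_le_sum fun i hi => Finset.sum_le_sum fun j hj => h i hi j hj
    _ = _ := by simp [mul_assoc]

/-- Sites are `N` distinct points of a lattice `L` in `ℝ ^ D`. With `v = C N ^ (1 - α / D)`, both
`2 v` (in the exponent) and `v` (in the denominator) are of order `N ^ (1 - α / D)`. -/
theorem mainTheorem3 (D : ℕ) (α : ℝ) (hα : 0 ≤ α) (hαD : α < D)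
    (L : Submodule ℤ (EuclideanSpace ℝ (Fin D))) [DiscreteTopology L] [IsZLattice ℝ L] :
    ∃ C : ℝ, 0 < C ∧
      ∀ (N : ℕ) (x : Fin N → EuclideanSpace ℝ (Fin D)),
        Function.Injective x → (∀ i, x i ∈ L) →
      ∀ (d : Fin N → ℕ) (h : Fin N → Fin N → ℝ → SpinOp d),
        (∀ i j, i < j → MeasureTheory.AEStronglyMeasurable (h i j)) →
        (∀ i j, i < j → ∀ s, (h i j s).IsHermitian) →
        (∀ i j, i < j → ∀ s, IsSupportedOn {i, j} (h i j s)) →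
        (∀ i j, i < j → ∀ s, ‖h i j s‖ ≤ 1 / dist (x i) (x j) ^ α) →
      ∀ (X Y : Finset (Fin N)), Disjoint X Y →
      ∀ (A B : SpinOp d), IsSupportedOn X A → IsSupportedOn Y B →
      ∀ t : ℝ, 0 ≤ t →
        ‖⁅heisenberg (hamiltonian h) A t, B⁆‖ ≤
          2 * ‖A‖ * ‖B‖ * (X.card : ℝ) * (Y.card : ℝ) *
            ((Real.exp (2 * (C * (N : ℝ) ^ (1 - α / D)) * t) - 1) /
              (C * (N : ℝ) ^ (1 - α / D) * regionDist x X Y ^ α)) := by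
  obtain ⟨C, hC, hrep⟩ := exists_inv_dist_rpow_reproducing hα hαD L
  refine ⟨C, hC, fun N x hx hxL d h hm hh hsupp hbd X Y hXY A B hA hB t ht => ?_⟩
  have key := fun (v : ℝ) (hv : 0 < v) => norm_commutator_heisenberg_le_sum
    (J := fun i j => 1 / dist (x i) (x j) ^ α) (v := v) hm hh hsupp hbd
    (fun i j => by positivity) (fun i j => by rw [dist_comm]) hv
  rcases Nat.eq_zero_or_pos N with rfl | hN
  -- For `N = 0` the rate is `0`, so an arbitrary positive `v` is used; both regions are empty and
  -- the bound is `0`.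
  · have := key 1 one_pos (fun i => i.elim0) hXY hA hB ht
    simpa [Finset.eq_empty_of_isEmpty X] using this
  · have hv : 0 < C * (N : ℝ) ^ (1 - α / D) := by positivity
    refine (key _ hv (hrep N x hx hxL) hXY hA hB ht).trans ?_
    set v := C * (N : ℝ) ^ (1 - α / D)
    calc _ ≤ 2 * ‖A‖ * ‖B‖ * ((X.card : ℝ) * (Y.card : ℝ) * (1 / regionDist x X Y ^ α) *
          ((Real.exp (2 * v * t) - 1) / v)) := by
          have := growth_nonneg hv ht
          gcongr
          exact sum_inv_dist_rpow_le_card hα hx hXY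
      _ = _ := by rw [mul_comm v, ← div_div]; ring
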